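/- A real square matrix is called Schur stable if all its complex eigenvalues lie in the open unit disk, and a set of matrices is called robustly Schur stable if each of its members is Schur stable. For $A,B\in\mathbb{R}^{n\times n}$ the bialternate product $A\cdot B$ is the real matrix with rows and columns indexed by the pairs $(p,q)$, $1\le p<q\le n$, and entries \[ (A\cdot B)_{pq,kl}=\frac12\left(\begin{vmatrix}a_{pk}&a_{pl}\\ b_{qk}&b_{ql}\end{vmatrix}+\begin{vmatrix}b_{pk}&b_{pl}\\ a_{qk}&a_{ql}\end{vmatrix}\right). \] Let $B_0\in\mathbb{R}^{n\times n}$ and let $A_i=B_0+B_i$ $(i=1,\dots,N)$ be Schur stable matrices, where $\operatorname{rank}(B_i)=1$ for all $i$ and either $B_i=bc_i^T$ for all $i$ with a common vector $b\in\mathbb{R}^n$ and $c_1,\dots,c_N\in\mathbb{R}^n$, or $B_i=b_ic^T$ for all $i$ with a common vector $c\in\mathbb{R}^n$ and $b_1,\dots,b_N\in\mathbb{R}^n$. For $i<j$ put \[ F_0^{ij}=I-A_j\cdot A_j,\qquad F_1^{ij}=-2\,(A_i\cdot A_j-A_j\cdot A_j). \] Then the polytope $\mathcal{A}=\operatorname{co}\{A_1,\dots,A_N\}$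 is robustly Schur stable if and only if the following two conditions hold: (i) for all $i<j$, neither $(I-A_i)(I-A_j)^{-1}$ nor $(I+A_i)(I+A_j)^{-1}$ has a negative real eigenvalue; (ii) for all $i<j$, the matrix $-(F_0^{ij})^{-1}F_1^{ij}$ has no real eigenvalue in $[1,\infty)$. Moreover, $\mathcal{A}$ is robustly Schur stable if and only if, for all $i<j$, the segment $[A_i,A_j]=\{\alpha A_i+(1-\alpha)A_j:\ \alpha\in[0,1]\}$ is robustly Schur stable. -/

import Mathlib

noncomputable section

namespace SchurPolytope

/-- A real square matrix is Schur stable if all its complex eigenvalues lie in the open unit disk. -/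
def SchurStable {n : ℕ} (A : Matrix (Fin n) (Fin n) ℝ) : Prop :=
  ∀ z : ℂ, Module.End.HasEigenvalue (Matrix.toLin' (A.map (algebraMap ℝ ℂ))) z → ‖z‖ < 1

/-- A family of matrices is robustly Schur stable if each of its members is Schur stable. -/
def RobustlySchurStable {n : ℕ} (S : Set (Matrix (Fin n) (Fin n) ℝ)) : Prop :=
  ∀ A ∈ S, SchurStable A

/-- The index set `{(p, q) : p < q}`, of cardinality `n (n - 1) / 2`. -/
abbrev Q2 (n : ℕ) : Type := {p : Fin n × Fin n // p.1 < p.2}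

/-- The bialternate product of two `n × n` matrices. -/
def bialternate {n : ℕ} (A B : Matrix (Fin n) (Fin n) ℝ) : Matrix (Q2 n) (Q2 n) ℝ :=
  Matrix.of fun r s =>
    (1 / 2 : ℝ) *
      (Matrix.det !![A r.1.1 s.1.1, A r.1.1 s.1.2; B r.1.2 s.1.1, B r.1.2 s.1.2] +
       Matrix.det !![B r.1.1 s.1.1, B r.1.1 s.1.2; A r.1.2 s.1.1, A r.1.2 s.1.2])

/-- The matrix `F₀ = I - A₂ · A₂` (bialternate product) of the pair `(A₁, A₂)`;
it does not depend on `A₁`. -/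
def F0 {n : ℕ} (_A₁ A₂ : Matrix (Fin n) (Fin n) ℝ) : Matrix (Q2 n) (Q2 n) ℝ :=
  1 - bialternate A₂ A₂

/-- The matrix `F₁ = -2 (A₁ · A₂ - A₂ · A₂)` (bialternate products) of the pair `(A₁, A₂)`. -/
def F1 {n : ℕ} (A₁ A₂ : Matrix (Fin n) (Fin n) ℝ) : Matrix (Q2 n) (Q2 n) ℝ :=
  (-2 : ℝ) • (bialternate A₁ A₂ - bialternate A₂ A₂)

/-- `μ` is a real eigenvalue of the real square matrix `M`. -/
def IsRealEigenvalue {ι : Type} [Fintype ι] [DecidableEq ι] (M : Matrix ι ι ℝ) (μ : ℝ) : Prop :=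
  Module.End.HasEigenvalue (Matrix.toLin' M) μ

end SchurPolytope

end

/-! The edge statement rests on one fact: on a rank-one family with a common factor, `det (z I - X)`
at fixed `z` is affine in the convex weights (`IsRankOneFamily.charDet_sum`). If the hull had an
unstable member, compactness would give an eigenvalue `z` of largest modulus, at least 1, over the
hull. Then 0 lies in the convex hull of the vertex values at `z`. Either 0 is on a segment between
two values, and an edge is unstable, or three values wind strictly around 0. Winding is an open
condition, so it survives at `t z` for some `t > 1`, against maximality.

On an edge, stability can only be lost through the unit circle: at 1, at -1, or at a nonreal pair
with product 1. The first two are singularities of `I - X` and `I + X`. For the third, the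
bialternate square is `V ↦ X V Xᵀ` on skew matrices: such a pair yields a fixed vector, while a
Schur stable `X` has none since its powers tend to 0. As the edge direction has rank at most one, `I
- X · X` is affine along the edge, namely `F0 + a F1`. Nonsingularity of each affine matrix pencil
is then an eigenvalue condition. -/

namespace SchurPolytope

open Matrix

/-! ### Eigenvalues and the characteristic determinant -/

/-- Eigenvalues of a matrix as nonzero solutions of `M v = μ v`. -/
theorem hasEigenvalue_toLin'_iff_exists {K ι : Type*} [Field K] [Fintype ι] [DecidableEq ι]
    (M : Matrix ι ι K) (μ : K) :
    Module.End.HasEigenvalue (Matrix.toLin' M) μ ↔ ∃ v, v ≠ 0 ∧ M *ᵥ v = μ • v := by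
  constructor
  · intro h
    obtain ⟨v, hv⟩ := h.exists_hasEigenvector
    exact ⟨v, hv.2, by simpa using hv.apply_eq_smul⟩
  · rintro ⟨v, hv, h⟩
    exact Module.End.hasEigenvalue_of_hasEigenvector
      ⟨Module.End.mem_eigenspace_iff.2 (by simpa using h), hv⟩

/-- The complex characteristic polynomial of `A`, evaluated at `z`. -/
noncomputable def charDet {n : ℕ} (A : Matrix (Fin n) (Fin n) ℝ) (z : ℂ) : ℂ :=
  (z • (1 : Matrix (Fin n) (Fin n) ℂ) - A.map (algebraMap ℝ ℂ)).det

theorem charDet_eq_eval_charpoly {n : ℕ} (A : Matrix (Fin n) (Fin n) ℝ) (z : ℂ) :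
    charDet A z = (A.map (algebraMap ℝ ℂ)).charpoly.eval z := by
  rw [Matrix.eval_charpoly, charDet, Matrix.scalar_apply, Matrix.smul_one_eq_diagonal]

theorem charDet_eq_zero_iff {n : ℕ} (A : Matrix (Fin n) (Fin n) ℝ) (z : ℂ) :
    charDet A z = 0 ↔ ∃ v, v ≠ 0 ∧ A.map (algebraMap ℝ ℂ) *ᵥ v = z • v := by
  rw [charDet, ← Matrix.exists_mulVec_eq_zero_iff]
  refine exists_congr fun v => and_congr_right fun _ => ?_
  rw [Matrix.sub_mulVec, Matrix.smul_mulVec, Matrix.one_mulVec, sub_eq_zero, eq_comm]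

theorem schurStable_iff {n : ℕ} (A : Matrix (Fin n) (Fin n) ℝ) :
    SchurStable A ↔ ∀ z, charDet A z = 0 → ‖z‖ < 1 := by
  simp only [SchurStable, hasEigenvalue_toLin'_iff_exists, charDet_eq_zero_iff]

theorem continuous_charDet {n : ℕ} :
    Continuous fun p : Matrix (Fin n) (Fin n) ℝ × ℂ => charDet p.1 p.2 := by
  unfold charDet
  refine Continuous.matrix_det ?_
  refine (continuous_snd.smul continuous_const).sub ?_
  exact continuous_fst.matrix_map Complex.continuous_ofReal

/-! ### Affine dependence on the weights -/

/-- By a Schur complement, `det (M + b vᵀ)` is the determinant of the bordered matrix with rows `(1,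
v)` and `(-b, M)`, which is linear in its first row. Because the weights sum to 1, the corner entry
stays 1. -/
theorem det_add_vecMulVec_sum {ι κ R : Type*} [Fintype ι] [DecidableEq ι] [Fintype κ]
    [CommRing R] (M : Matrix ι ι R) (b : ι → R) (c : κ → ι → R) (a : κ → R)
    (ha : ∑ k, a k = 1) :
    (M + vecMulVec b (∑ k, a k • c k)).det = ∑ k, a k * (M + vecMulVec b (c k)).det := by
  let F : Matrix (Unit ⊕ ι) (Unit ⊕ ι) R := fromBlocks 1 0 (-replicateCol Unit b) M
  have key (v : ι → R) :
      (M + vecMulVec b v).det = (F.updateRow (Sum.inl ()) (Sum.elim 1 v)).det := by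
    have h : F.updateRow (Sum.inl ()) (Sum.elim 1 v) =
        fromBlocks 1 (replicateRow Unit v) (-replicateCol Unit b) M := by
      ext i j
      rcases i with i | i <;> rcases j with j | j <;> simp [F]
    rw [h, det_fromBlocks_one₁₁, vecMulVec_eq Unit, Matrix.neg_mul, sub_neg_eq_add]
  have hsum : (Sum.elim 1 (∑ k, a k • c k) : Unit ⊕ ι → R) =
      ∑ k, a k • (Sum.elim 1 (c k) : Unit ⊕ ι → R) := by
    ext i
    rcases i with i | i <;> simp [ha]
  simp only [key]
  rw [hsum]
  have h := map_sum ((detRowAlternating (R := R)).toMultilinearMap.toLinearMap F (Sum.inl ()))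
    (fun k => a k • (Sum.elim 1 (c k) : Unit ⊕ ι → R)) Finset.univ
  simp only [map_smul, smul_eq_mul] at h
  exact h

/-- A family of rank-one perturbations of one matrix that share a column or a row factor. -/
def IsRankOneFamily {n : ℕ} {κ : Type*} (A : κ → Matrix (Fin n) (Fin n) ℝ) : Prop :=
  ∃ B₀ : Matrix (Fin n) (Fin n) ℝ,
    (∃ (b : Fin n → ℝ) (c : κ → Fin n → ℝ), ∀ k, A k = B₀ + vecMulVec b (c k)) ∨
    (∃ (b : κ → Fin n → ℝ) (c : Fin n → ℝ), ∀ k, A k = B₀ + vecMulVec (b k) c)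

theorem IsRankOneFamily.comp {n : ℕ} {κ κ' : Type*} {A : κ → Matrix (Fin n) (Fin n) ℝ}
    (h : IsRankOneFamily A) (f : κ' → κ) : IsRankOneFamily (fun k => A (f k)) := by
  obtain ⟨B₀, ⟨b, c, h⟩ | ⟨b, c, h⟩⟩ := h
  · exact ⟨B₀, Or.inl ⟨b, fun k => c (f k), fun k => h _⟩⟩
  · exact ⟨B₀, Or.inr ⟨fun k => b (f k), c, fun k => h _⟩⟩

theorem charDet_add_vecMulVec {n : ℕ} (B₀ : Matrix (Fin n) (Fin n) ℝ) (b c : Fin n → ℝ) (z : ℂ) :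
    charDet (B₀ + vecMulVec b c) z =
      (z • (1 : Matrix (Fin n) (Fin n) ℂ) - B₀.map (algebraMap ℝ ℂ) +
        vecMulVec (fun i => -(b i : ℂ)) (fun i => (c i : ℂ))).det := by
  rw [charDet]
  congr 1
  ext i j
  simp [vecMulVec_apply]
  ring

theorem charDet_transpose {n : ℕ} (A : Matrix (Fin n) (Fin n) ℝ) (z : ℂ) :
    charDet Aᵀ z = charDet A z := by
  rw [charDet, charDet, ← det_transpose]
  simp [transpose_sub, transpose_smul, transpose_map]

/-- On a rank-one family the characteristic polynomial is an affine function of the weights. -/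
theorem IsRankOneFamily.charDet_sum {n : ℕ} {κ : Type*} [Fintype κ]
    {A : κ → Matrix (Fin n) (Fin n) ℝ} (h : IsRankOneFamily A) (a : κ → ℝ) (ha : ∑ k, a k = 1)
    (z : ℂ) : charDet (∑ k, a k • A k) z = ∑ k, a k • charDet (A k) z := by
  have main (B₀ : Matrix (Fin n) (Fin n) ℝ) (b : Fin n → ℝ) (c : κ → Fin n → ℝ) :
      charDet (∑ k, a k • (B₀ + vecMulVec b (c k))) z =
        ∑ k, a k • charDet (B₀ + vecMulVec b (c k)) z := by
    have h1 : ∑ k, a k • (B₀ + vecMulVec b (c k)) = B₀ + vecMulVec b (∑ k, a k • c k) := by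
      ext i j
      simp only [Matrix.sum_apply, Matrix.smul_apply, Matrix.add_apply, vecMulVec_apply,
        Finset.sum_apply, Pi.smul_apply, smul_eq_mul, mul_add, Finset.sum_add_distrib,
        ← Finset.sum_mul, ha, one_mul, Finset.mul_sum]
      congr 1
      exact Finset.sum_congr rfl fun k _ => by ring
    have h2 := det_add_vecMulVec_sum
      (z • (1 : Matrix (Fin n) (Fin n) ℂ) - B₀.map (algebraMap ℝ ℂ))
      (fun i => -(b i : ℂ)) (fun k i => (c k i : ℂ)) (fun k => (a k : ℂ))
      (by exact_mod_cast ha)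
    simp only [h1, charDet_add_vecMulVec, Complex.real_smul]
    rw [← h2]
    congr 3
    ext i
    simp
  obtain ⟨B₀, ⟨b, c, h⟩ | ⟨b, c, h⟩⟩ := h
  · simp only [h, main]
  · have h3 := main B₀ᵀ c b
    have h4 : ∑ k, a k • (B₀ᵀ + vecMulVec c (b k)) = (∑ k, a k • A k)ᵀ := by
      simp [h, transpose_sum, transpose_smul, transpose_add, transpose_vecMulVec]
    have h5 (k) : B₀ᵀ + vecMulVec c (b k) = (A k)ᵀ := by
      simp [h, transpose_add, transpose_vecMulVec]
    rw [h4, charDet_transpose] at h3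
    simpa only [h5, charDet_transpose] using h3

/-! ### The origin in planar convex hulls -/

/-- The oriented area of the parallelogram spanned by two complex numbers. -/
def cross (u v : ℂ) : ℝ := u.re * v.im - u.im * v.re

/-- Cramer's rule in the plane. When the three areas are positive, normalising them gives convex
weights that represent 0. -/
theorem cross_smul_add_cyclic (u v w : ℂ) :
    cross v w • u + cross w u • v + cross u v • w = 0 := by
  apply Complex.ext <;> simp [cross] <;> ring

theorem exists_smul_of_cross_eq_zero {u v : ℂ} (hu : u ≠ 0) (h : cross u v = 0) :
    ∃ r : ℝ, v = r • u := by
  have hn : u.re ^ 2 + u.im ^ 2 ≠ 0 := by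
    intro h0
    exact hu (Complex.ext (by simp; nlinarith [sq_nonneg u.re, sq_nonneg u.im])
      (by simp; nlinarith [sq_nonneg u.re, sq_nonneg u.im]))
  unfold cross at h
  refine ⟨(u.re * v.re + u.im * v.im) / (u.re ^ 2 + u.im ^ 2), Complex.ext ?_ ?_⟩
  · simp only [Complex.smul_re, smul_eq_mul]
    field_simp
    linear_combination (-u.im) * h
  · simp only [Complex.smul_im, smul_eq_mul]
    field_simp
    linear_combination u.re * h

theorem zero_mem_segment_of_smul {u v : ℂ} {a b : ℝ} (ha : 0 ≤ a) (hb : 0 ≤ b) (hab : 0 < a + b)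
    (h : a • u + b • v = 0) : (0 : ℂ) ∈ segment ℝ u v := by
  refine ⟨a / (a + b), b / (a + b), by positivity, by positivity, by field_simp, ?_⟩
  have : (a / (a + b)) • u + (b / (a + b)) • v = (a + b)⁻¹ • (a • u + b • v) := by
    simp only [smul_add, smul_smul, div_eq_inv_mul]
  rw [this, h, smul_zero]

theorem pos_smul_of_zero_notMem_segment {u v : ℂ} (hu : (0 : ℂ) ∉ segment ℝ u v) (h0 : u ≠ 0)
    (h : cross u v = 0) : ∃ r : ℝ, 0 < r ∧ v = r • u := by
  obtain ⟨r, hr⟩ := exists_smul_of_cross_eq_zero h0 h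
  refine ⟨r, ?_, hr⟩
  by_contra! hr0
  refine hu (zero_mem_segment_of_smul (a := -r) (b := 1) (by linarith) zero_le_one (by linarith) ?_)
  rw [hr]
  simp

/-- If three complex numbers have the origin in their convex hull but not on a side, then they
wind around it. -/
theorem cross_pos_or_neg_of_sum_eq_zero {u v w : ℂ} {a b c : ℝ} (ha : 0 ≤ a) (hb : 0 ≤ b)
    (hc : 0 ≤ c) (habc : a + b + c = 1) (h : a • u + b • v + c • w = 0)
    (huv : (0 : ℂ) ∉ segment ℝ u v) (hvw : (0 : ℂ) ∉ segment ℝ v w)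
    (hwu : (0 : ℂ) ∉ segment ℝ w u) :
    (0 < cross u v ∧ 0 < cross v w ∧ 0 < cross w u) ∨
      (cross u v < 0 ∧ cross v w < 0 ∧ cross w u < 0) := by
  have ha' : 0 < a := by
    refine lt_of_le_of_ne ha fun h0 => hvw ?_
    subst h0
    exact zero_mem_segment_of_smul hb hc (by linarith) (by simpa using h)
  have hb' : 0 < b := by
    refine lt_of_le_of_ne hb fun h0 => hwu ?_
    subst h0
    exact zero_mem_segment_of_smul hc ha (by linarith) (by rw [add_comm]; simpa using h)
  have hc' : 0 < c := by
    refine lt_of_le_of_ne hc fun h0 => huv ?_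
    subst h0
    exact zero_mem_segment_of_smul ha hb (by linarith) (by simpa using h)
  have hre : a * u.re + b * v.re + c * w.re = 0 := by simpa using congrArg Complex.re h
  have him : a * u.im + b * v.im + c * w.im = 0 := by simpa using congrArg Complex.im h
  -- Taking the cross product of the vanishing combination with `u` and with `v` shows that the
  -- three areas have the same sign.
  have e1 : b * cross u v = c * cross w u := by
    unfold cross
    linear_combination u.re * him - u.im * hre
  have e2 : a * cross u v = c * cross v w := by
    unfold cross
    linear_combination (-v.re) * him + v.im * hre
  have hvw' : cross v w = a / c * cross u v := by field_simp; linarith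
  have hwu' : cross w u = b / c * cross u v := by field_simp; linarith
  rcases lt_trichotomy (cross u v) 0 with h0 | h0 | h0
  · right
    rw [hvw', hwu']
    exact ⟨h0, mul_neg_of_pos_of_neg (by positivity) h0, mul_neg_of_pos_of_neg (by positivity) h0⟩
  · exfalso
    -- If the areas vanish, `v` and `w` are positive multiples of `u`, and a positive combination
    -- cannot be 0.
    have hu0 : u ≠ 0 := by
      rintro rfl
      exact huv (left_mem_segment ℝ _ _)
    have huw : cross u w = 0 := by
      have : cross w u = 0 := by rw [hwu', h0, mul_zero]
      unfold cross at *
      linarith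
    obtain ⟨r, hr, rfl⟩ := pos_smul_of_zero_notMem_segment huv hu0 h0
    obtain ⟨s, hs, rfl⟩ := pos_smul_of_zero_notMem_segment (by rwa [segment_symm]) hu0 huw
    rw [smul_smul, smul_smul, ← add_smul, ← add_smul, smul_eq_zero] at h
    rcases h with h | h
    · have : 0 < a + b * r + c * s := by positivity
      exact this.ne' h
    · exact hu0 h
  · left
    rw [hvw', hwu']
    exact ⟨h0, by positivity, by positivity⟩

/-- Carathéodory: 0 is a positive combination of affinely independent values, hence of at most three
in the plane. One or two of them give a segment. -/
theorem exists_zero_mem_segment_or_cross_pos {κ : Type*} {w : κ → ℂ}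
    (h : (0 : ℂ) ∈ convexHull ℝ (Set.range w)) :
    (∃ i j, (0 : ℂ) ∈ segment ℝ (w i) (w j)) ∨
      ∃ i j k, 0 < cross (w i) (w j) ∧ 0 < cross (w j) (w k) ∧ 0 < cross (w k) (w i) := by
  obtain ⟨ι, _, p, a, hp, hind, ha, hsum, h0⟩ := eq_pos_convex_span_of_mem_convexHull h
  have hcard : Fintype.card ι ≤ 3 := by
    have := hind.card_le_finrank_succ
    refine this.trans ?_
    have h2 : Module.finrank ℝ (vectorSpan ℝ (Set.range p)) ≤ Module.finrank ℝ ℂ :=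
      Submodule.finrank_le _
    rw [Complex.finrank_real_complex] at h2
    omega
  choose f hf using fun i => hp (Set.mem_range_self i)
  rw [← (Fintype.equivFin ι).symm.sum_comp] at hsum h0
  simp only [← hf] at h0
  generalize (Fintype.equivFin ι).symm = e' at *
  generalize Fintype.card ι = m at *
  interval_cases m
  · simp at hsum
  · left
    refine ⟨f (e' 0), f (e' 0), ?_⟩
    simp at hsum h0
    rw [hsum] at h0
    simp at h0
    rw [h0]
    exact left_mem_segment ℝ _ _
  · left
    rw [Fin.sum_univ_two] at hsum h0
    exact ⟨_, _, _, _, (ha _).le, (ha _).le, hsum, h0⟩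
  · rw [Fin.sum_univ_three] at hsum h0
    by_contra! hne
    obtain ⟨hseg, hcr⟩ := hne
    rcases cross_pos_or_neg_of_sum_eq_zero (ha _).le (ha _).le (ha _).le hsum h0
      (hseg _ _) (hseg _ _) (hseg _ _) with ⟨h1, h2, h3⟩ | ⟨h1, h2, h3⟩
    · exact absurd h3 (not_lt.2 (hcr _ _ _ h1 h2))
    -- A negatively oriented triple is positively oriented in reverse order.
    · have anti (u v : ℂ) (h : cross u v < 0) : 0 < cross v u := by
        unfold cross at *; linarith
      exact absurd (anti _ _ h1) (not_lt.2 (hcr _ _ _ (anti _ _ h3) (anti _ _ h2)))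

/-! ### The edge theorem -/

theorem norm_le_of_charDet_eq_zero {n : ℕ} {A : Matrix (Fin n) (Fin n) ℝ} {z : ℂ}
    (h : charDet A z = 0) : ‖z‖ ≤ ∑ i, ∑ j, |A i j| := by
  obtain ⟨v, hv, hz⟩ := (charDet_eq_zero_iff A z).1 h
  have hv' : 0 < ‖v‖ := norm_pos_iff.2 hv
  refine le_of_mul_le_mul_right ?_ hv'
  rw [← norm_smul, ← hz, pi_norm_le_iff_of_nonneg (by positivity)]
  intro i
  calc ‖(A.map (algebraMap ℝ ℂ) *ᵥ v) i‖ ≤ ∑ j, ‖(A i j : ℂ) * v j‖ := by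
        simpa [mulVec, dotProduct] using norm_sum_le Finset.univ fun j => (A i j : ℂ) * v j
    _ ≤ ∑ j, |A i j| * ‖v‖ := by
        refine Finset.sum_le_sum fun j _ => ?_
        rw [norm_mul, Complex.norm_real, Real.norm_eq_abs]
        exact mul_le_mul_of_nonneg_left (norm_le_pi_norm v j) (abs_nonneg _)
    _ = (∑ j, |A i j|) * ‖v‖ := by rw [Finset.sum_mul]
    _ ≤ _ := by
        refine mul_le_mul_of_nonneg_right ?_ hv'.le
        exact Finset.single_le_sum (f := fun i => ∑ j, |A i j|) (fun _ _ => by positivity)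
          (Finset.mem_univ i)

/-- The eigenvalues outside the open unit disk of the members of a compact family form a compact
set. -/
theorem isCompact_unstable_pairs {n : ℕ} {S : Set (Matrix (Fin n) (Fin n) ℝ)} (hS : IsCompact S) :
    IsCompact {p : Matrix (Fin n) (Fin n) ℝ × ℂ | p.1 ∈ S ∧ 1 ≤ ‖p.2‖ ∧ charDet p.1 p.2 = 0} := by
  have hc : Continuous fun A : Matrix (Fin n) (Fin n) ℝ => ∑ i, ∑ j, |A i j| := by fun_prop
  obtain ⟨R, hR⟩ := (hS.image hc).bddAbove
  refine (hS.prod (isCompact_closedBall (0 : ℂ) R)).of_isClosed_subset ?_ ?_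
  · have : T2Space (Matrix (Fin n) (Fin n) ℝ) := inferInstance
    exact (hS.isClosed.preimage continuous_fst).inter
      ((isClosed_le continuous_const continuous_snd.norm).inter
        (isClosed_eq continuous_charDet continuous_const))
  · rintro ⟨A, z⟩ ⟨hA, -, h0⟩
    refine ⟨hA, ?_⟩
    simpa using (norm_le_of_charDet_eq_zero h0).trans (hR ⟨A, hA, rfl⟩)

/-- The edge theorem: the convex hull of a finite rank-one family is robustly Schur stable as soon
as all segments between its members are. -/
theorem IsRankOneFamily.robustlySchurStable_convexHull {n : ℕ} {κ : Type*} [Finite κ]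
    {A : κ → Matrix (Fin n) (Fin n) ℝ} (hA : IsRankOneFamily A)
    (hseg : ∀ i j, RobustlySchurStable (segment ℝ (A i) (A j))) :
    RobustlySchurStable (convexHull ℝ (Set.range A)) := by
  classical
  have := Fintype.ofFinite κ
  have hcomp := isCompact_unstable_pairs ((Set.finite_range A).isCompact_convexHull ℝ)
  intro X hX
  rw [schurStable_iff]
  intro x hx
  by_contra! hx1
  -- An unstable eigenvalue `z` of maximal modulus over the whole hull.
  obtain ⟨⟨Y, z⟩, ⟨hY, hz1, hz0⟩, hmax⟩ := hcomp.exists_isMaxOn ⟨(X, x), hX, hx1, hx⟩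
    (continuous_norm.comp continuous_snd).continuousOn
  simp only at hY hz1 hz0
  have hhull : (0 : ℂ) ∈ convexHull ℝ (Set.range fun i => charDet (A i) z) := by
    obtain ⟨ι, _, a, B, ha, hsum, hB, rfl⟩ := mem_convexHull_iff_exists_fintype.1 hY
    choose f hf using hB
    have h1 := (hA.comp f).charDet_sum a hsum z
    simp only [hf, hz0] at h1
    refine mem_convexHull_iff_exists_fintype.2
      ⟨ι, inferInstance, a, fun k => charDet (A (f k)) z, ha, hsum, fun k => ⟨f k, rfl⟩, ?_⟩
    simp only [hf, ← h1]
  rcases exists_zero_mem_segment_or_cross_pos hhull with ⟨i, j, a, b, ha, hb, hab, h0⟩ |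
    ⟨i, j, k, hij, hjk, hki⟩
  · have h1 := (hA.comp ![i, j]).charDet_sum ![a, b] (by simpa using hab) z
    simp only [Fin.sum_univ_two, cons_val_zero, cons_val_one, h0] at h1
    exact absurd ((schurStable_iff _).1 (hseg i j _ ⟨a, b, ha, hb, hab, rfl⟩) z h1) (not_lt.2 hz1)
  · have hcont (l : κ) : Continuous fun t : ℝ => charDet (A l) (t • z) :=
      continuous_charDet.comp (f := fun t : ℝ => (A l, t • z)) (by fun_prop)
    have hcr (l m : κ) (h : 0 < cross (charDet (A l) z) (charDet (A m) z)) :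
        ∀ᶠ t : ℝ in nhds 1, 0 < cross (charDet (A l) (t • z)) (charDet (A m) (t • z)) := by
      have hc : Continuous fun t : ℝ => cross (charDet (A l) (t • z)) (charDet (A m) (t • z)) := by
        unfold cross
        have h1 := Complex.continuous_re.comp (hcont l)
        have h2 := Complex.continuous_im.comp (hcont l)
        have h3 := Complex.continuous_re.comp (hcont m)
        have h4 := Complex.continuous_im.comp (hcont m)
        exact (h1.mul h4).sub (h2.mul h3)
      exact hc.continuousAt.eventually_const_lt (by simpa using h)
    have hev := ((hcr i j hij).and ((hcr j k hjk).and (hcr k i hki)))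
    -- The winding persists for `t` near 1, so some `t > 1` makes `t • z` an eigenvalue of a hull
    -- member.
    obtain ⟨t, ⟨h1, h2, h3⟩, ht⟩ := ((hev.filter_mono nhdsWithin_le_nhds).and
      (self_mem_nhdsWithin (s := Set.Ioi (1 : ℝ)))).exists
    have hsmul := cross_smul_add_cyclic (charDet (A i) (t • z)) (charDet (A j) (t • z))
      (charDet (A k) (t • z))
    set p := cross (charDet (A j) (t • z)) (charDet (A k) (t • z))
    set q := cross (charDet (A k) (t • z)) (charDet (A i) (t • z))
    set r := cross (charDet (A i) (t • z)) (charDet (A j) (t • z))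
    have hs : 0 < p + q + r := by positivity
    have hw : p / (p + q + r) + q / (p + q + r) + r / (p + q + r) = 1 := by field_simp
    have hdet := (hA.comp ![i, j, k]).charDet_sum
      ![p / (p + q + r), q / (p + q + r), r / (p + q + r)]
      (by simpa [Fin.sum_univ_three] using hw) (t • z)
    have hcomb : (p / (p + q + r)) • charDet (A i) (t • z) +
        (q / (p + q + r)) • charDet (A j) (t • z) +
        (r / (p + q + r)) • charDet (A k) (t • z) = 0 := by
      rw [← smul_zero (p + q + r)⁻¹, ← hsmul]
      simp only [smul_add, smul_smul, div_eq_inv_mul]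
    simp only [Fin.sum_univ_three, cons_val_zero, cons_val_one, cons_val_two, tail_cons,
      head_cons, hcomb] at hdet
    have hmem (l : κ) : A l ∈ convexHull ℝ (Set.range A) :=
      subset_convexHull ℝ _ ⟨l, rfl⟩
    have hnorm : ‖t • z‖ = t * ‖z‖ := by
      rw [norm_smul, Real.norm_of_nonneg (zero_le_one.trans (le_of_lt ht))]
    have ht1 : (1 : ℝ) < t := ht
    have hle := hmax (a := (_, t • z)) ⟨(convex_convexHull ℝ (Set.range A)).sum_mem
      (t := Finset.univ) (w := ![p / (p + q + r), q / (p + q + r), r / (p + q + r)])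
      (z := fun l => A (![i, j, k] l))
      (by intro l _; fin_cases l <;> simp <;> positivity)
      (by simpa [Fin.sum_univ_three] using hw) (fun l _ => hmem _),
      by rw [hnorm]; nlinarith, by simpa [Fin.sum_univ_three, add_assoc] using hdet⟩
    simp only [Function.comp, hnorm, Set.mem_ofPred_eq] at hle
    nlinarith

/-! ### Powers of a Schur stable matrix -/

/-- Gelfand's formula: for `r` strictly between the spectral radius and 1, eventually `‖a ^ k‖ ≤ r ^
k`. -/
theorem tendsto_pow_zero_of_forall_mem_spectrum {𝔸 : Type*} [NormedRing 𝔸] [NormedAlgebra ℂ 𝔸]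
    [CompleteSpace 𝔸] [Nontrivial 𝔸] (a : 𝔸) (h : ∀ z ∈ spectrum ℂ a, ‖z‖ < 1) :
    Filter.Tendsto (fun k : ℕ => ‖a ^ k‖) Filter.atTop (nhds 0) := by
  have hρ : spectralRadius ℂ a < (1 : NNReal) :=
    spectrum.spectralRadius_lt_of_forall_lt a fun z hz => by
      rw [← NNReal.coe_lt_coe]; simpa using h z hz
  obtain ⟨r, hr, hr1⟩ := ENNReal.lt_iff_exists_nnreal_btwn.1 hρ
  have hev := (spectrum.pow_nnnorm_pow_one_div_tendsto_nhds_spectralRadius a).eventually_lt_const hr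
  have hr1' : (r : ℝ) < 1 := by exact_mod_cast hr1
  refine squeeze_zero' (Filter.Eventually.of_forall fun k => norm_nonneg _) ?_
    (tendsto_pow_atTop_nhds_zero_of_lt_one r.2 hr1')
  filter_upwards [hev, Filter.eventually_gt_atTop 0] with k hk hk0
  have hk0' : (0 : ℝ) < k := by exact_mod_cast hk0
  have h1 := hk.le
  rw [one_div, ENNReal.rpow_inv_le_iff hk0', ENNReal.rpow_natCast] at h1
  exact_mod_cast h1

section LinftyNorm

attribute [local instance] Matrix.linftyOpNormedRing Matrix.linftyOpNormedAlgebra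

theorem SchurStable.tendsto_pow_apply {n : ℕ} {A : Matrix (Fin n) (Fin n) ℝ} (hA : SchurStable A)
    (i j : Fin n) : Filter.Tendsto (fun k : ℕ => (A ^ k) i j) Filter.atTop (nhds 0) := by
  have : Nonempty (Fin n) := ⟨i⟩
  have : CompleteSpace (Matrix (Fin n) (Fin n) ℂ) := FiniteDimensional.complete ℂ _
  have hspec : ∀ z ∈ spectrum ℂ (A.map (algebraMap ℝ ℂ)), ‖z‖ < 1 := by
    intro z hz
    refine hA z ?_
    rwa [Module.End.hasEigenvalue_iff_mem_spectrum, spectrum_toLin']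
  refine squeeze_zero_norm (fun k => ?_) (tendsto_pow_zero_of_forall_mem_spectrum _ hspec)
  have h1 : ‖(A ^ k) i j‖ = ‖((A.map (algebraMap ℝ ℂ)) ^ k) i j‖ := by
    rw [← Matrix.map_pow]
    simp
  rw [h1]
  generalize (A.map (algebraMap ℝ ℂ)) ^ k = M
  rw [linfty_opNorm_def, ← coe_nnnorm, NNReal.coe_le_coe]
  exact (Finset.single_le_sum (f := fun j => ‖M i j‖₊) (fun _ _ => zero_le)
    (Finset.mem_univ j)).trans
    (Finset.le_sup (f := fun i => ∑ j, ‖M i j‖₊) (Finset.mem_univ i))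

end LinftyNorm

theorem SchurStable.tendsto_pow {n : ℕ} {A : Matrix (Fin n) (Fin n) ℝ} (hA : SchurStable A) :
    Filter.Tendsto (fun k : ℕ => A ^ k) Filter.atTop (nhds 0) :=
  tendsto_pi_nhds.2 fun i => tendsto_pi_nhds.2 fun j => hA.tendsto_pow_apply i j

/-- A Schur stable `A` fixes no nonzero matrix under `V ↦ A V Aᵀ`. -/
theorem SchurStable.eq_zero_of_mul_mul_transpose {n : ℕ} {A V : Matrix (Fin n) (Fin n) ℝ}
    (hA : SchurStable A) (h : A * V * Aᵀ = V) : V = 0 := by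
  have hk (k : ℕ) : A ^ k * V * (A ^ k)ᵀ = V := by
    induction k with
    | zero => simp
    | succ k ih =>
      rw [pow_succ, transpose_mul]
      calc A ^ k * A * V * (Aᵀ * (A ^ k)ᵀ) = A ^ k * (A * V * Aᵀ) * (A ^ k)ᵀ := by
            simp only [Matrix.mul_assoc]
        _ = V := by rw [h, ih]
  -- The constant sequence `A ^ k V (A ^ k)ᵀ = V` has limit 0.
  have hc : Continuous fun M : Matrix (Fin n) (Fin n) ℝ => M * V * Mᵀ := by fun_prop
  have ht := (hc.tendsto 0).comp hA.tendsto_pow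
  simp only [Function.comp_def, hk, Matrix.zero_mul] at ht
  exact tendsto_nhds_unique tendsto_const_nhds ht

/-! ### The bialternate square on skew-symmetric matrices -/

theorem sum_sum_eq_sum_Q2 {n : ℕ} (f : Fin n → Fin n → ℝ) (hf : ∀ k, f k k = 0) :
    ∑ k, ∑ l, f k l = ∑ s : Q2 n, (f s.1.1 s.1.2 + f s.1.2 s.1.1) := by
  have h1 : ∑ k, ∑ l, f k l = ∑ k, ∑ l, (if k < l then f k l + f l k else 0) := by
    have h2 : ∑ k, ∑ l, f k l =
        ∑ k, ∑ l, (if k < l then f k l else 0) + ∑ k, ∑ l, (if l < k then f k l else 0) := by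
      simp only [← Finset.sum_add_distrib]
      refine Finset.sum_congr rfl fun k _ => Finset.sum_congr rfl fun l _ => ?_
      rcases lt_trichotomy k l with h | h | h
      · simp [h, h.le]
      · subst h; simp [hf]
      · simp [h, h.le]
    rw [h2, Finset.sum_comm (f := fun k l => if l < k then f k l else 0)]
    simp only [← Finset.sum_add_distrib]
    refine Finset.sum_congr rfl fun k _ => Finset.sum_congr rfl fun l _ => ?_
    split_ifs <;> simp
  rw [h1, ← Finset.sum_product', Finset.univ_product_univ, ← Finset.sum_filter]
  exact Finset.sum_subtype _ (by simp) (fun p : Fin n × Fin n => f p.1 p.2 + f p.2 p.1)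

/-- The coordinates of a skew-symmetric matrix above the diagonal. -/
def upper {n : ℕ} (V : Matrix (Fin n) (Fin n) ℝ) (s : Q2 n) : ℝ := V s.1.1 s.1.2

/-- The skew-symmetric matrix with given coordinates above the diagonal. -/
def skew {n : ℕ} (v : Q2 n → ℝ) : Matrix (Fin n) (Fin n) ℝ :=
  Matrix.of fun p q => if h : p < q then v ⟨(p, q), h⟩ else if h : q < p then -v ⟨(q, p), h⟩ else 0

theorem upper_skew {n : ℕ} (v : Q2 n → ℝ) : upper (skew v) = v := by
  ext ⟨⟨p, q⟩, h⟩
  have h' : p < q := h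
  simp [upper, skew, h']

theorem transpose_skew {n : ℕ} (v : Q2 n → ℝ) : (skew v)ᵀ = -skew v := by
  ext p q
  rcases lt_trichotomy p q with h | h | h
  · simp [skew, h, h.le]
  · subst h; simp [skew]
  · simp [skew, h, h.not_gt]

theorem eq_of_upper_eq {n : ℕ} {V W : Matrix (Fin n) (Fin n) ℝ} (hV : Vᵀ = -V) (hW : Wᵀ = -W)
    (h : upper V = upper W) : V = W := by
  have hV' (p q) : V q p = -V p q := congrFun₂ hV p q
  have hW' (p q) : W q p = -W p q := congrFun₂ hW p q
  ext p q
  rcases lt_trichotomy p q with hpq | hpq | hpq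
  · exact congrFun h ⟨(p, q), hpq⟩
  · subst hpq
    linarith [hV' p p, hW' p p]
  · have := congrFun h ⟨(q, p), hpq⟩
    simp only [upper] at this
    rw [hV' q p, hW' q p, this]

/-- On skew-symmetric matrices, the bialternate square of `A` acts as `V ↦ A V Aᵀ`. -/
theorem bialternate_self_mulVec_upper {n : ℕ} (A : Matrix (Fin n) (Fin n) ℝ)
    {V : Matrix (Fin n) (Fin n) ℝ} (hV : Vᵀ = -V) :
    bialternate A A *ᵥ upper V = upper (A * V * Aᵀ) := by
  have hV' (p q) : V q p = -V p q := congrFun₂ hV p q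
  ext r
  have h1 : upper (A * V * Aᵀ) r = ∑ k, ∑ l, A r.1.1 k * V k l * A r.1.2 l := by
    simp only [upper, Matrix.mul_apply, transpose_apply, Finset.sum_mul]
    exact Finset.sum_comm
  rw [h1, sum_sum_eq_sum_Q2]
  · simp only [mulVec, dotProduct]
    refine Finset.sum_congr rfl fun s _ => ?_
    rw [hV' s.1.1 s.1.2]
    simp only [bialternate, upper, of_apply, det_fin_two_of]
    ring
  · intro k
    have : V k k = 0 := by linarith [hV' k k]
    simp [this]

theorem SchurStable.eq_zero_of_bialternate_mulVec_eq {n : ℕ} {A : Matrix (Fin n) (Fin n) ℝ}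
    (hA : SchurStable A) {v : Q2 n → ℝ} (h : bialternate A A *ᵥ v = v) : v = 0 := by
  have hV := transpose_skew v
  have h1 := bialternate_self_mulVec_upper A hV
  rw [upper_skew, h] at h1
  have h2 : A * skew v * Aᵀ = skew v := by
    refine eq_of_upper_eq ?_ hV (by rw [← h1, upper_skew])
    simp [transpose_mul, hV, Matrix.mul_assoc]
  rw [← upper_skew v, hA.eq_zero_of_mul_mul_transpose h2]
  rfl

/-- A pair of nonreal eigenvalues on the unit circle gives a fixed vector of the bialternate
square. -/
theorem exists_bialternate_mulVec_eq_of_norm_eq_one {n : ℕ} {A : Matrix (Fin n) (Fin n) ℝ} {z : ℂ}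
    (hz : charDet A z = 0) (hz1 : ‖z‖ = 1) (him : z.im ≠ 0) :
    ∃ v, v ≠ 0 ∧ bialternate A A *ᵥ v = v := by
  obtain ⟨x, hx, hAx⟩ := (charDet_eq_zero_iff A z).1 hz
  let u : Fin n → ℝ := fun i => (x i).re
  let w : Fin n → ℝ := fun i => (x i).im
  have hu : A *ᵥ u = z.re • u - z.im • w := by
    ext i
    simpa [mulVec, dotProduct, u, w] using congrArg Complex.re (congrFun hAx i)
  have hw : A *ᵥ w = z.im • u + z.re • w := by
    ext i
    have := congrArg Complex.im (congrFun hAx i)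
    simp [mulVec, dotProduct] at this
    simp [mulVec, dotProduct, u, w, this]
    ring
  have hz2 : z.re * z.re + z.im * z.im = 1 := by
    rw [← Complex.normSq_apply, Complex.normSq_eq_norm_sq, hz1, one_pow]
  -- `V` is the wedge of `u` and `w`. On these vectors `A` acts by a 2 by 2 matrix of determinant
  -- `|z|² = 1`, so `V` is fixed.
  let V := vecMulVec u w - vecMulVec w u
  have hVt : Vᵀ = -V := by
    simp [V, transpose_sub, transpose_vecMulVec]
  have hAV : A * V * Aᵀ = V := by
    have h1 : A * V * Aᵀ = vecMulVec (A *ᵥ u) (A *ᵥ w) - vecMulVec (A *ᵥ w) (A *ᵥ u) := by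
      simp [V, Matrix.mul_sub, Matrix.sub_mul, mul_vecMulVec, vecMulVec_mul, vecMul_transpose]
    rw [h1, hu, hw]
    ext i j
    simp only [V, Matrix.sub_apply, vecMulVec_apply, Pi.sub_apply, Pi.add_apply,
      Pi.smul_apply, smul_eq_mul]
    linear_combination (u i * w j - w i * u j) * hz2
  refine ⟨upper V, fun h0 => ?_, by rw [bialternate_self_mulVec_upper A hVt, hAV]⟩
  -- If `V = 0`, then `u` and `w` are parallel, hence so are `A u` and `A w` in the same ratio. At a
  -- coordinate where `x` is nonzero this forces `z.im = 0`.
  have hV0 : V = 0 := eq_of_upper_eq hVt (by simp) h0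
  have hpar (p q) : u p * w q = w p * u q := by
    have := congrFun₂ hV0 p q
    simp only [V, Matrix.sub_apply, vecMulVec_apply, Matrix.zero_apply] at this
    linarith
  obtain ⟨q, hq⟩ := Function.ne_iff.1 hx
  have huq := congrFun hu q
  have hwq := congrFun hw q
  have hpar2 : (A *ᵥ u) q * w q = (A *ᵥ w) q * u q := by
    simp only [mulVec, dotProduct, Finset.sum_mul, mul_assoc, hpar _ q]
  rw [huq, hwq] at hpar2
  simp only [Pi.sub_apply, Pi.add_apply, Pi.smul_apply, smul_eq_mul] at hpar2
  have h3 : z.im * (u q ^ 2 + w q ^ 2) = 0 := by linarith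
  have h4 : u q ^ 2 + w q ^ 2 = 0 := (mul_eq_zero.1 h3).resolve_left him
  exact hq (Complex.ext (by simp; nlinarith [sq_nonneg (u q), sq_nonneg (w q)])
    (by simp; nlinarith [sq_nonneg (u q), sq_nonneg (w q)]))

/-! ### Loss of stability through the unit circle -/

theorem not_schurStable_iff {n : ℕ} (A : Matrix (Fin n) (Fin n) ℝ) :
    ¬SchurStable A ↔ ∃ z, 1 ≤ ‖z‖ ∧ charDet A z = 0 := by
  rw [schurStable_iff]
  push Not
  exact exists_congr fun z => and_comm

/-- Each root factor satisfies `‖z - a‖ ≥ ‖z‖ - 1`. This bound replaces continuity of the roots: a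
matrix whose determinant at `z` is too small cannot be stable. -/
theorem SchurStable.sub_one_pow_le_norm_charDet {n : ℕ} {A : Matrix (Fin n) (Fin n) ℝ}
    (hA : SchurStable A) {z : ℂ} (hz : 1 ≤ ‖z‖) : (‖z‖ - 1) ^ n ≤ ‖charDet A z‖ := by
  have hmon := Matrix.charpoly_monic (A.map (algebraMap ℝ ℂ))
  have hspl := IsAlgClosed.splits (A.map (algebraMap ℝ ℂ)).charpoly
  have hroots : ∀ w ∈ (A.map (algebraMap ℝ ℂ)).charpoly.roots, ‖w‖ < 1 := by
    intro w hw
    refine (schurStable_iff A).1 hA w ?_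
    rw [charDet_eq_eval_charpoly]
    exact Polynomial.isRoot_of_mem_roots hw
  have hcard : (A.map (algebraMap ℝ ℂ)).charpoly.roots.card = n := by
    rw [← hspl.natDegree_eq_card_roots, Matrix.charpoly_natDegree_eq_dim, Fintype.card_fin]
  rw [charDet_eq_eval_charpoly, hspl.eval_eq_prod_roots_of_monic hmon]
  generalize (A.map (algebraMap ℝ ℂ)).charpoly.roots = s at hroots hcard
  rw [← hcard]
  clear hcard
  induction s using Multiset.induction_on with
  | empty => simp
  | cons a s ih =>
    rw [Multiset.card_cons, pow_succ', Multiset.map_cons, Multiset.prod_cons, norm_mul]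
    have h1 : ‖z‖ - 1 ≤ ‖z - a‖ := by
      have := hroots a (Multiset.mem_cons_self a s)
      linarith [norm_sub_norm_le z a]
    exact mul_le_mul h1 (ih fun w hw => hroots w (Multiset.mem_cons_of_mem hw))
      (pow_nonneg (by linarith) _) (norm_nonneg _)

theorem isOpen_not_schurStable_of_norm_ne_one {n : ℕ} {X : Type*} [TopologicalSpace X]
    {A : X → Matrix (Fin n) (Fin n) ℝ} (hA : Continuous A)
    (hcircle : ∀ x z, ‖z‖ = 1 → charDet (A x) z ≠ 0) : IsOpen {x | ¬SchurStable (A x)} := by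
  refine isOpen_iff_mem_nhds.2 fun x hx => ?_
  obtain ⟨z, hz, h0⟩ := (not_schurStable_iff _).1 hx
  have hz1 : 1 < ‖z‖ := lt_of_le_of_ne hz fun h => hcircle x z h.symm h0
  have hc : Continuous fun y => ‖charDet (A y) z‖ :=
    (continuous_charDet.comp (f := fun y => (A y, z)) (by fun_prop)).norm
  have hlt : ‖charDet (A x) z‖ < (‖z‖ - 1) ^ n := by
    rw [h0, norm_zero]
    exact pow_pos (by linarith) n
  have hev := hc.continuousAt.eventually_lt_const hlt
  filter_upwards [hev] with y hy hst
  exact absurd (hst.sub_one_pow_le_norm_charDet hz) (not_le.2 hy)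

/-- The unstable members of `S` are the projection of a compact set of matrix-eigenvalue pairs. -/
theorem isClosed_not_schurStable {n : ℕ} {X : Type*} [TopologicalSpace X]
    {A : X → Matrix (Fin n) (Fin n) ℝ} (hA : Continuous A)
    {S : Set (Matrix (Fin n) (Fin n) ℝ)} (hS : IsCompact S) (hAS : ∀ x, A x ∈ S) :
    IsClosed {x | ¬SchurStable (A x)} := by
  have h := ((isCompact_unstable_pairs hS).image continuous_fst).isClosed.preimage hA
  convert h using 1
  ext x
  simp only [Set.mem_ofPred_eq, Set.mem_preimage, Set.mem_image, Prod.exists, exists_and_right,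
    exists_eq_right, not_schurStable_iff]
  exact exists_congr fun z => ⟨fun h => ⟨hAS x, h⟩, fun h => h.2⟩

/-- A segment that starts at a Schur stable matrix and whose members have no eigenvalue on the unit
circle is robustly Schur stable. -/
theorem schurStable_of_forall_norm_eq_one {n : ℕ} {A₁ A₂ : Matrix (Fin n) (Fin n) ℝ}
    (h₂ : SchurStable A₂)
    (hcircle : ∀ a ∈ Set.Icc (0 : ℝ) 1, ∀ z, ‖z‖ = 1 → charDet (a • A₁ + (1 - a) • A₂) z ≠ 0)
    {a : ℝ} (ha : a ∈ Set.Icc (0 : ℝ) 1) : SchurStable (a • A₁ + (1 - a) • A₂) := by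
  let F : Set.Icc (0 : ℝ) 1 → Matrix (Fin n) (Fin n) ℝ := fun a => (a : ℝ) • A₁ + (1 - (a : ℝ)) • A₂
  have hF : Continuous F := by fun_prop
  -- The parameter interval is connected, so the clopen unstable set is empty or everything;
  -- parameter 0, where the matrix is `A₂`, excludes the latter.
  have hclopen : IsClopen {x | ¬SchurStable (F x)} :=
    ⟨isClosed_not_schurStable hF (isCompact_range hF) fun x => ⟨x, rfl⟩,
      isOpen_not_schurStable_of_norm_ne_one hF fun x => hcircle x x.2⟩
  have h0 : (0 : Set.Icc (0 : ℝ) 1) ∉ {x | ¬SchurStable (F x)} := by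
    simpa [F] using h₂
  rcases isClopen_iff.1 hclopen with h | h
  · have h1 : (⟨a, ha⟩ : Set.Icc (0 : ℝ) 1) ∉ {x | ¬SchurStable (F x)} := by simp [h]
    simpa [F] using h1
  · exact absurd (h ▸ Set.mem_univ _) h0

/-! ### Singular members of matrix segments -/

theorem charDet_ofReal {n : ℕ} (A : Matrix (Fin n) (Fin n) ℝ) (r : ℝ) :
    charDet A r = ((r • (1 : Matrix (Fin n) (Fin n) ℝ) - A).det : ℝ) := by
  have h := RingHom.map_det (algebraMap ℝ ℂ) (r • (1 : Matrix (Fin n) (Fin n) ℝ) - A)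
  rw [Complex.coe_algebraMap] at h
  rw [h, charDet]
  congr 1
  ext i j
  by_cases hij : i = j <;> simp [hij]

theorem charDet_one_eq_zero_iff {n : ℕ} (A : Matrix (Fin n) (Fin n) ℝ) :
    charDet A 1 = 0 ↔ (1 - A).det = 0 := by
  have := charDet_ofReal A 1
  rw [Complex.ofReal_one, one_smul] at this
  rw [this, Complex.ofReal_eq_zero]

theorem charDet_neg_one_eq_zero_iff {n : ℕ} (A : Matrix (Fin n) (Fin n) ℝ) :
    charDet A (-1) = 0 ↔ (1 + A).det = 0 := by
  have h := charDet_ofReal A (-1)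
  have h1 : (-1 : ℝ) • (1 : Matrix (Fin n) (Fin n) ℝ) - A = -(1 + A) := by
    rw [neg_one_smul]; abel
  rw [Complex.ofReal_neg, Complex.ofReal_one, h1, det_neg] at h
  rw [h, Complex.ofReal_eq_zero, mul_eq_zero, or_iff_right (pow_ne_zero _ (by norm_num))]

/-- A segment of matrices with nonsingular end points is nonsingular exactly when `M₁ M₂⁻¹` has no
negative real eigenvalue. -/
theorem forall_not_isRealEigenvalue_mul_inv_iff {ι : Type} [Fintype ι] [DecidableEq ι]
    {M₁ M₂ : Matrix ι ι ℝ} (h₁ : M₁.det ≠ 0) (h₂ : M₂.det ≠ 0) :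
    (∀ μ : ℝ, μ < 0 → ¬IsRealEigenvalue (M₁ * M₂⁻¹) μ) ↔
      ∀ a ∈ Set.Icc (0 : ℝ) 1, (a • M₁ + (1 - a) • M₂).det ≠ 0 := by
  have hu : IsUnit M₂.det := isUnit_iff_ne_zero.2 h₂
  constructor
  · intro h a ha h0
    obtain ⟨v, hv, hv0⟩ := exists_mulVec_eq_zero_iff.2 h0
    rcases ha.1.eq_or_lt with rfl | ha0
    · exact h₂ (by simpa using h0)
    rcases ha.2.eq_or_lt with rfl | ha1
    · exact h₁ (by simpa using h0)
    refine h (-((1 - a) / a)) (neg_neg_of_pos (div_pos (by linarith) ha0)) ?_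
    rw [IsRealEigenvalue, hasEigenvalue_toLin'_iff_exists]
    refine ⟨M₂ *ᵥ v, fun hw => h₂ (exists_mulVec_eq_zero_iff.1 ⟨v, hv, hw⟩), ?_⟩
    rw [mulVec_mulVec, Matrix.mul_assoc, nonsing_inv_mul _ hu, Matrix.mul_one]
    rw [add_mulVec, smul_mulVec, smul_mulVec, add_eq_zero_iff_eq_neg] at hv0
    rw [← inv_smul_smul₀ ha0.ne' (M₁ *ᵥ v), hv0, smul_neg, smul_smul, neg_smul, div_eq_inv_mul]
  · intro h μ hμ hev
    rw [IsRealEigenvalue, hasEigenvalue_toLin'_iff_exists] at hev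
    obtain ⟨v, hv, hμv⟩ := hev
    have hμ1 : 0 < 1 - μ := by linarith
    -- The weight `a` solving `μ = -(1 - a) / a`.
    refine h (1 - μ)⁻¹ ⟨by positivity, inv_le_one_of_one_le₀ (by linarith)⟩
      (exists_mulVec_eq_zero_iff.1 ⟨M₂⁻¹ *ᵥ v, fun hw => hv ?_, ?_⟩)
    · rw [← one_mulVec v, ← mul_nonsing_inv _ hu, ← mulVec_mulVec, hw, mulVec_zero]
    · rw [add_mulVec, smul_mulVec, smul_mulVec, mulVec_mulVec, mulVec_mulVec, hμv,
        mul_nonsing_inv _ hu, one_mulVec, smul_smul, ← add_smul]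
      have : (1 - μ)⁻¹ * μ + (1 - (1 - μ)⁻¹) = 0 := by field_simp; ring
      rw [this, zero_smul]

/-- For `a ≠ 0`, a kernel vector of `M₀ + a M₁` is an eigenvector of `-M₀⁻¹ M₁` for `1 / a`, and `a
↦ 1 / a` maps `(0, 1]` onto `[1, ∞)`. At `a = 0` the matrix is `M₀`. -/
theorem forall_not_isRealEigenvalue_neg_inv_mul_iff {ι : Type} [Fintype ι] [DecidableEq ι]
    {M₀ M₁ : Matrix ι ι ℝ} (h₀ : M₀.det ≠ 0) :
    (∀ μ ∈ Set.Ici (1 : ℝ), ¬IsRealEigenvalue (-(M₀⁻¹ * M₁)) μ) ↔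
      ∀ a ∈ Set.Icc (0 : ℝ) 1, (M₀ + a • M₁).det ≠ 0 := by
  have hu : IsUnit M₀.det := isUnit_iff_ne_zero.2 h₀
  constructor
  · intro h a ha hdet
    obtain ⟨v, hv, hv0⟩ := exists_mulVec_eq_zero_iff.2 hdet
    rcases ha.1.eq_or_lt with rfl | ha0
    · exact h₀ (by simpa using hdet)
    refine h a⁻¹ ((one_le_inv₀ ha0).2 ha.2) ?_
    rw [IsRealEigenvalue, hasEigenvalue_toLin'_iff_exists]
    refine ⟨v, hv, ?_⟩
    rw [add_mulVec, smul_mulVec, add_eq_zero_iff_neg_eq] at hv0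
    rw [neg_mulVec, ← mulVec_mulVec, ← inv_smul_smul₀ ha0.ne' (M₁ *ᵥ v), ← hv0, mulVec_smul,
      mulVec_neg, mulVec_mulVec, nonsing_inv_mul _ hu, one_mulVec, smul_neg, neg_neg]
  · intro h μ hμ hev
    rw [IsRealEigenvalue, hasEigenvalue_toLin'_iff_exists] at hev
    obtain ⟨v, hv, hμv⟩ := hev
    have hμ1 : (1 : ℝ) ≤ μ := hμ
    have hμ0 : 0 < μ := by linarith
    refine h μ⁻¹ ⟨by positivity, inv_le_one_of_one_le₀ hμ1⟩
      (exists_mulVec_eq_zero_iff.1 ⟨v, hv, ?_⟩)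
    have h1 : M₁ *ᵥ v = -(μ • M₀ *ᵥ v) := by
      have h2 := congrArg (fun x => M₀ *ᵥ x) hμv
      simp only [neg_mulVec, mulVec_neg, mulVec_smul, mulVec_mulVec, ← Matrix.mul_assoc,
        mul_nonsing_inv _ hu, Matrix.one_mul] at h2
      rw [← h2, neg_neg]
    rw [add_mulVec, smul_mulVec, h1, smul_neg, smul_smul, inv_mul_cancel₀ hμ0.ne', one_smul,
      add_neg_cancel]

/-! ### The criterion on an edge and the assembly -/

/-- Along a segment with rank-one direction the bialternate square is affine. -/
theorem one_sub_bialternate_segment {n : ℕ} {A₁ A₂ : Matrix (Fin n) (Fin n) ℝ} {b c : Fin n → ℝ}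
    (h : A₁ = A₂ + vecMulVec b c) (a : ℝ) :
    1 - bialternate (a • A₁ + (1 - a) • A₂) (a • A₁ + (1 - a) • A₂) = F0 A₁ A₂ + a • F1 A₁ A₂ := by
  -- The coefficient of `a²` is the bialternate square of `b cᵀ`, which vanishes because its entries
  -- are 2 by 2 minors of a matrix of rank at most one.
  subst h
  ext r s
  simp only [F0, F1, bialternate, det_fin_two_of, of_apply, Matrix.sub_apply, Matrix.add_apply,
    Matrix.smul_apply, smul_eq_mul, vecMulVec_apply]
  ring

theorem SchurStable.det_one_sub_bialternate_ne_zero {n : ℕ} {A : Matrix (Fin n) (Fin n) ℝ}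
    (hA : SchurStable A) : (1 - bialternate A A).det ≠ 0 := by
  intro h
  obtain ⟨v, hv, hv0⟩ := exists_mulVec_eq_zero_iff.2 h
  rw [sub_mulVec, one_mulVec, sub_eq_zero] at hv0
  exact hv (hA.eq_zero_of_bialternate_mulVec_eq hv0.symm)

theorem SchurStable.charDet_ne_zero {n : ℕ} {A : Matrix (Fin n) (Fin n) ℝ}
    (hA : SchurStable A) {z : ℂ} (hz : ‖z‖ = 1) : charDet A z ≠ 0 := fun h =>
  absurd hz ((schurStable_iff A).1 hA z h).ne

theorem robustlySchurStable_segment_iff_forall {n : ℕ} {A₁ A₂ : Matrix (Fin n) (Fin n) ℝ} :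
    RobustlySchurStable (segment ℝ A₁ A₂) ↔
      ∀ a ∈ Set.Icc (0 : ℝ) 1, SchurStable (a • A₁ + (1 - a) • A₂) := by
  constructor
  · intro h a ha
    exact h _ ⟨a, 1 - a, ha.1, by linarith [ha.2], by ring, rfl⟩
  · rintro h _ ⟨a, b, ha, hb, hab, rfl⟩
    obtain rfl : b = 1 - a := by linarith
    exact h a ⟨ha, by linarith⟩

/-- The eigenvalue criterion for robust Schur stability of a segment with rank-one direction. -/
theorem robustlySchurStable_segment_iff {n : ℕ} {A₁ A₂ : Matrix (Fin n) (Fin n) ℝ}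
    (h₁ : SchurStable A₁) (h₂ : SchurStable A₂) {b c : Fin n → ℝ}
    (h : A₁ = A₂ + vecMulVec b c) :
    RobustlySchurStable (segment ℝ A₁ A₂) ↔
      ((∀ μ : ℝ, μ < 0 → ¬IsRealEigenvalue ((1 - A₁) * (1 - A₂)⁻¹) μ) ∧
        (∀ μ : ℝ, μ < 0 → ¬IsRealEigenvalue ((1 + A₁) * (1 + A₂)⁻¹) μ)) ∧
      ∀ μ ∈ Set.Ici (1 : ℝ), ¬IsRealEigenvalue (-((F0 A₁ A₂)⁻¹ * F1 A₁ A₂)) μ := by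
  have hsub {A : Matrix (Fin n) (Fin n) ℝ} (hA : SchurStable A) : (1 - A).det ≠ 0 :=
    fun h0 => hA.charDet_ne_zero norm_one ((charDet_one_eq_zero_iff A).2 h0)
  have hadd {A : Matrix (Fin n) (Fin n) ℝ} (hA : SchurStable A) : (1 + A).det ≠ 0 :=
    fun h0 => hA.charDet_ne_zero (by simp) ((charDet_neg_one_eq_zero_iff A).2 h0)
  have esub (a : ℝ) : a • (1 - A₁) + (1 - a) • (1 - A₂) = 1 - (a • A₁ + (1 - a) • A₂) := by
    module
  have eadd (a : ℝ) : a • (1 + A₁) + (1 - a) • (1 + A₂) = 1 + (a • A₁ + (1 - a) • A₂) := by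
    module
  rw [robustlySchurStable_segment_iff_forall,
    forall_not_isRealEigenvalue_mul_inv_iff (hsub h₁) (hsub h₂),
    forall_not_isRealEigenvalue_mul_inv_iff (hadd h₁) (hadd h₂),
    forall_not_isRealEigenvalue_neg_inv_mul_iff
      (M₀ := F0 A₁ A₂) h₂.det_one_sub_bialternate_ne_zero]
  simp only [esub, eadd, ← one_sub_bialternate_segment h]
  constructor
  · exact fun hst => ⟨⟨fun a ha => hsub (hst a ha), fun a ha => hadd (hst a ha)⟩,
      fun a ha => (hst a ha).det_one_sub_bialternate_ne_zero⟩
  · rintro ⟨⟨hone, hneg⟩, hbi⟩ a ha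
    refine schurStable_of_forall_norm_eq_one h₂ (fun a ha z hz h0 => ?_) ha
    -- A real eigenvalue on the circle is 1 or -1; a nonreal one is excluded through the bialternate
    -- square.
    by_cases him : z.im = 0
    · have hre : z = (z.re : ℂ) := Complex.ext rfl (by simpa using him)
      have habs : |z.re| = 1 := by rw [← hz, hre]; simp
      rcases eq_or_eq_neg_of_abs_eq habs with h1 | h1
      · rw [hre, h1, Complex.ofReal_one, charDet_one_eq_zero_iff] at h0
        exact hone a ha h0
      · rw [hre, h1, Complex.ofReal_neg, Complex.ofReal_one, charDet_neg_one_eq_zero_iff] at h0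
        exact hneg a ha h0
    · obtain ⟨v, hv, hv0⟩ := exists_bialternate_mulVec_eq_of_norm_eq_one h0 hz him
      refine hbi a ha (exists_mulVec_eq_zero_iff.1 ⟨v, hv, ?_⟩)
      rw [sub_mulVec, one_mulVec, hv0, sub_self]

theorem IsRankOneFamily.exists_eq_add_vecMulVec {n : ℕ} {κ : Type*}
    {A : κ → Matrix (Fin n) (Fin n) ℝ} (h : IsRankOneFamily A) (i j : κ) :
    ∃ b c, A i = A j + vecMulVec b c := by
  obtain ⟨B₀, ⟨b, c, h⟩ | ⟨b, c, h⟩⟩ := h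
  · refine ⟨b, c i - c j, ?_⟩
    rw [h, h, vecMulVec_sub]
    abel
  · refine ⟨b i - b j, c, ?_⟩
    rw [h, h, sub_vecMulVec]
    abel

theorem IsRankOneFamily.robustlySchurStable_convexHull_iff {n N : ℕ}
    {A : Fin N → Matrix (Fin n) (Fin n) ℝ} (hA : IsRankOneFamily A)
    (hstable : ∀ i, SchurStable (A i)) :
    RobustlySchurStable (convexHull ℝ (Set.range A)) ↔
      ∀ i j : Fin N, i < j → RobustlySchurStable (segment ℝ (A i) (A j)) := by
  constructor
  · intro h i j _ X hX
    exact h X (segment_subset_convexHull (Set.mem_range_self i) (Set.mem_range_self j) hX)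
  · intro h
    refine hA.robustlySchurStable_convexHull fun i j => ?_
    rcases lt_trichotomy i j with hij | rfl | hij
    · exact h i j hij
    · rw [segment_same]
      rintro _ rfl
      exact hstable i
    · rw [segment_symm]
      exact h j i hij

end SchurPolytope

theorem mainTheorem5 {n N : ℕ}
    (B₀ : Matrix (Fin n) (Fin n) ℝ)
    (B A : Fin N → Matrix (Fin n) (Fin n) ℝ)
    (hA : ∀ i, A i = B₀ + B i)
    (hrank : ∀ i, (B i).rank = 1)
    (hB : (∃ (b : Fin n → ℝ) (c : Fin N → Fin n → ℝ), ∀ i, B i = Matrix.vecMulVec b (c i)) ∨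
          (∃ (b : Fin N → Fin n → ℝ) (c : Fin n → ℝ), ∀ i, B i = Matrix.vecMulVec (b i) c))
    (hstable : ∀ i, SchurPolytope.SchurStable (A i)) :
    (SchurPolytope.RobustlySchurStable (convexHull ℝ (Set.range A)) ↔
      (∀ i j : Fin N, i < j →
        (∀ μ : ℝ, μ < 0 →
          ¬ SchurPolytope.IsRealEigenvalue ((1 - A i) * (1 - A j)⁻¹) μ) ∧
        (∀ μ : ℝ, μ < 0 →
          ¬ SchurPolytope.IsRealEigenvalue ((1 + A i) * (1 + A j)⁻¹) μ)) ∧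
      (∀ i j : Fin N, i < j →
        ∀ μ ∈ Set.Ici (1 : ℝ),
          ¬ SchurPolytope.IsRealEigenvalue
            (-((SchurPolytope.F0 (A i) (A j))⁻¹ * SchurPolytope.F1 (A i) (A j))) μ)) ∧
    (SchurPolytope.RobustlySchurStable (convexHull ℝ (Set.range A)) ↔
      ∀ i j : Fin N, i < j →
        SchurPolytope.RobustlySchurStable (segment ℝ (A i) (A j))) := by
  have hfam : SchurPolytope.IsRankOneFamily A := by
    rcases hB with ⟨b, c, h⟩ | ⟨b, c, h⟩
    · exact ⟨B₀, Or.inl ⟨b, c, fun k => by rw [hA, h]⟩⟩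
    · exact ⟨B₀, Or.inr ⟨b, c, fun k => by rw [hA, h]⟩⟩
  have hedge := hfam.robustlySchurStable_convexHull_iff hstable
  refine ⟨?_, hedge⟩
  choose b c hbc using hfam.exists_eq_add_vecMulVec
  have hpair (i j : Fin N) :=
    SchurPolytope.robustlySchurStable_segment_iff (hstable i) (hstable j) (hbc i j)
  rw [hedge]
  simp only [hpair]
  exact ⟨fun h => ⟨fun i j hij => (h i j hij).1, fun i j hij => (h i j hij).2⟩,
    fun h i j hij => ⟨h.1 i j hij, h.2 i j hij⟩⟩
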